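/- Let $R$ be a profinite ring with unity, not necessarily commutative. An étale space of (right) $R$-modules $(\mathcal A,p,X)$ consists of a profinite space $X$, a topological space $\mathcal A$, a local homeomorphism $p\colon\mathcal A\to X$, and the structure of a right $R$-module on each fibre $A_x=p^{-1}(x)$, such that the zero section $X\to\mathcal A$, the addition $\mathcal A\times_X\mathcal A\to\mathcal A$ and the action $\mathcal A\times R\to\mathcal A$ are continuous (so that each $A_x$ is a discrete $R$-module). A morphism $(\phi,f)\colon(\mathcal A,p,X)\to(\mathcal B,q,Y)$ consists of a continuous map $f\colon Y\to X$ and a continuous map $\phi\colon\mathcal A\times_X Y\to\mathcal B$ that restricts to an $R$-module homomorphism $A_{f(y)}\times\{y\}\to B_y$ for each $y\in Y$. The continuous product $\dot\prod\mathcal A$ is the discrete $R$-module of all global sections of $p$ (continuous maps $s\colon X\to\mathcal A$ with $p\circ s=\mathrm{id}_X$) with pointwise operations; it is a functor, a morphism $(\phi,f)$ sending $s$ to the section $y\mapsto\phi(s(f(y)),y)$. Let $I$ be a non-empty directed set and let $(\mathcal A_i,p_i,X_i)_{i\in I}$, with morphisms $(\phi_{ij},f_{ij})$ from $\mathcal A_i$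 to $\mathcal A_j$ for $i\le j$, be a directed system of étale spaces of $R$-modules. Put $X=\varprojlim X_i$, and let $\varinjlim\mathcal A_i$ be the quotient space of $\bigsqcup_i\mathcal A_i\times_{X_i}X$ in which $(a,x)\in\mathcal A_i\times_{X_i}X$ and $(b,y)\in\mathcal A_j\times_{X_j}X$ are identified if and only if $x=y$ and $\phi_{ik}(a,x_k)=\phi_{jk}(b,x_k)$ for some $k\ge i,j$, where $x_k$ is the image of $x$ in $X_k$; let $p\colon\varinjlim\mathcal A_i\to X$ be the projection. Then: 1. The fibres of $p$ carry $R$-module structures making $(\varinjlim\mathcal A_i,p,X)$ an étale space of $R$-modules such that the projections $X\to X_i$ and the canonical maps $\mathcal A_i\times_{X_i}X\to\varinjlim\mathcal A_i$ form morphisms of étale spaces of $R$-modules, and with these morphisms it is the direct limit (colimit) of the system in the category of étale spaces of $R$-modules. 2. The continuous product commutes with this direct limit: the canonical map $$\varinjlim\dot\prod\mathcal A_i\longrightarrow\dot\prod\varinjlim\mathcal A_i$$ is an isomorphism of discrete $R$-modules. Here the direct limit on the left may be taken in the category of discrete $R$-modules or in that of all $R$-modules. -/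

import Mathlib

open CategoryTheory CategoryTheory.Limits

universe u w

/-- The fibre of a map `p : A → X` over the point `x`. -/
@[ext]
structure EtFibre {A X : Type u} (p : A → X) (x : X) : Type u where
  val : A
  property : p val = x

/-- The structure of an étale space of (right) `R`-modules on a map `p : A → X`: the map `p` is a
local homeomorphism, every fibre of `p` is a right `R`-module (that is, a module over the opposite
ring), and the zero section `o : X → A`, the addition `A ×_X A → A` and the action `A × R → A` are
continuous. (The fibres are then discrete, and `R` acts continuously on them.) -/
structure EtaleModStr (R : Type w) [Ring R] [TopologicalSpace R] {A X : Type u}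
    [TopologicalSpace A] [TopologicalSpace X] (p : A → X) where
  isLocalHomeomorph : IsLocalHomeomorph p
  [addCommGroup : ∀ x : X, AddCommGroup (EtFibre p x)]
  [module : ∀ x : X, Module Rᵐᵒᵖ (EtFibre p x)]
  continuous_zero : Continuous fun x : X => (0 : EtFibre p x).1
  continuous_add : Continuous fun z : {z : A × A // p z.1 = p z.2} =>
    ((⟨z.1.1, z.2⟩ : EtFibre p (p z.1.2)) + ⟨z.1.2, rfl⟩).1
  continuous_smul : Continuous fun z : A × R =>
    (MulOpposite.op z.2 • (⟨z.1, rfl⟩ : EtFibre p (p z.1))).1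

/-- An étale space `(A, p, X)` of (right) `R`-modules over a profinite space `X`. -/
structure EtaleMod (R : Type w) [Ring R] [TopologicalSpace R] where
  base : Profinite.{u}
  total : Type u
  [top : TopologicalSpace total]
  proj : total → base
  str : EtaleModStr R proj

namespace EtaleMod

variable {R : Type w} [Ring R] [TopologicalSpace R]

instance (E : EtaleMod.{u, w} R) : TopologicalSpace E.total := E.top

/-- The fibre `A_x` of an étale space of `R`-modules. -/
abbrev Fibre (E : EtaleMod.{u, w} R) (x : E.base) : Type u := EtFibre E.proj x

instance (E : EtaleMod.{u, w} R) (x : E.base) : AddCommGroup (E.Fibre x) := E.str.addCommGroup x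

instance (E : EtaleMod.{u, w} R) (x : E.base) : Module Rᵐᵒᵖ (E.Fibre x) := E.str.module x

/-- A morphism `(φ, f) : (A, p, X) → (B, q, Y)` of étale spaces of `R`-modules: a continuous map
`f : Y → X` and `R`-linear maps `φ_y : A_{f(y)} → B_y`, for `y ∈ Y`, which together form a
continuous map `φ : A ×_X Y → B`. -/
@[ext]
structure Hom (E F : EtaleMod.{u, w} R) where
  base : C(F.base, E.base)
  fib : ∀ y : F.base, E.Fibre (base y) →ₗ[Rᵐᵒᵖ] F.Fibre y
  continuous_fib : Continuous fun z : {z : E.total × F.base // E.proj z.1 = base z.2} =>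
    (fib z.1.2 ⟨z.1.1, z.2⟩).1

/-- The identity morphism of an étale space of `R`-modules. -/
def Hom.id (E : EtaleMod.{u, w} R) : Hom E E where
  base := ContinuousMap.id _
  fib _ := LinearMap.id
  continuous_fib := continuous_fst.comp continuous_subtype_val

/-- The composite `(ψ, g) ∘ (φ, f)`, whose map of bases is `f ∘ g`. -/
def Hom.comp {E F G : EtaleMod.{u, w} R} (f : Hom E F) (g : Hom F G) : Hom E G where
  base := f.base.comp g.base
  fib z := (g.fib z).comp (f.fib (g.base z))
  continuous_fib := by
    have h1 : Continuous fun z : {z : E.total × G.base // E.proj z.1 = (f.base.comp g.base) z.2} =>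
        (f.fib (g.base z.1.2) ⟨z.1.1, z.2⟩).1 :=
      f.continuous_fib.comp (Continuous.subtype_mk
        (f := fun z : {z : E.total × G.base // E.proj z.1 = (f.base.comp g.base) z.2} =>
          ((z.1.1, g.base z.1.2) : E.total × F.base)) (by fun_prop) fun z => z.2)
    exact g.continuous_fib.comp (Continuous.subtype_mk
      (f := fun z : {z : E.total × G.base // E.proj z.1 = (f.base.comp g.base) z.2} =>
        (((f.fib (g.base z.1.2) ⟨z.1.1, z.2⟩).1, z.1.2) : F.total × G.base))
      (h1.prodMk (by fun_prop)) fun z => (f.fib (g.base z.1.2) ⟨z.1.1, z.2⟩).2)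

/-- The category of étale spaces of `R`-modules. -/
instance : Category.{u} (EtaleMod.{u, w} R) where
  Hom := Hom
  id := Hom.id
  comp := Hom.comp

/-- The continuous product of an étale space of `R`-modules: the `R`-module of its global sections
(continuous maps `s : X → A` with `p ∘ s = id`) with the pointwise operations. -/
def sections (E : EtaleMod.{u, w} R) : Submodule Rᵐᵒᵖ (∀ x : E.base, E.Fibre x) where
  carrier := {s | Continuous fun x => (s x).1}
  zero_mem' := E.str.continuous_zero
  add_mem' {s t} hs ht := by
    have h := E.str.continuous_add.comp (Continuous.subtype_mk
      (f := fun x : E.base => (((s x).1, (t x).1) : E.total × E.total))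
      (Continuous.prodMk hs ht) fun x => (s x).2.trans (t x).2.symm)
    refine h.congr fun x => ?_
    have key : ∀ (y z : E.base) (e : z = y) (a b : E.total) (ha : E.proj a = y)
        (hb : E.proj b = y) (ha' : E.proj a = z) (hb' : E.proj b = z),
        ((⟨a, ha⟩ : E.Fibre y) + ⟨b, hb⟩).1 = ((⟨a, ha'⟩ : E.Fibre z) + ⟨b, hb'⟩).1 := by
      rintro y z rfl a b ha hb ha' hb'
      rfl
    exact key _ _ (t x).2.symm _ _ _ _ _ _
  smul_mem' r s hs := by
    have h := E.str.continuous_smul.comp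
      (Continuous.prodMk (f := fun x : E.base => (s x).1) hs
        (continuous_const (y := MulOpposite.unop r)))
    refine h.congr fun x => ?_
    have key : ∀ (y z : E.base) (e : z = y) (a : E.total) (ha : E.proj a = y)
        (ha' : E.proj a = z),
        (r • (⟨a, ha⟩ : E.Fibre y)).1 = (r • (⟨a, ha'⟩ : E.Fibre z)).1 := by
      rintro y z rfl a ha ha'
      rfl
    exact key _ _ (s x).2.symm _ _ _

/-- The map of continuous products induced by a morphism `(φ, f)`: it sends `s` to the section
`y ↦ φ(s(f(y)), y)`. -/
def sectionsMap {E F : EtaleMod.{u, w} R} (f : E ⟶ F) : E.sections →ₗ[Rᵐᵒᵖ] F.sections where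
  toFun s := ⟨fun y => Hom.fib f y (s.1 (Hom.base f y)), by
    have hs : Continuous fun x => (s.1 x).1 := s.2
    exact (Hom.continuous_fib f).comp (Continuous.subtype_mk
      (f := fun y : F.base => (((s.1 (Hom.base f y)).1, y) : E.total × F.base))
      ((hs.comp (Hom.base f).continuous).prodMk continuous_id)
      fun y => (s.1 (Hom.base f y)).2)⟩
  map_add' s t := by
    apply Subtype.ext
    funext y
    exact map_add (Hom.fib f y) _ _
  map_smul' r s := by
    apply Subtype.ext
    funext y
    exact map_smul (Hom.fib f y) _ _

end EtaleMod

/-- A right `R`-module is discrete if the action `M × R → M` is continuous when `M` has the discrete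
topology. -/
def IsDiscreteModule (R : Type w) [Ring R] [TopologicalSpace R] :
    ObjectProperty (ModuleCat.{u} Rᵐᵒᵖ) := fun M =>
  letI : TopologicalSpace M := ⊥
  Continuous fun z : M × R => MulOpposite.op z.2 • z.1

/-- The category of discrete right `R`-modules. -/
abbrev DMod (R : Type w) [Ring R] [TopologicalSpace R] :=
  (IsDiscreteModule.{u, w} R).FullSubcategory

theorem EtaleMod.sections_isDiscrete {R : Type w} [Ring R] [TopologicalSpace R]
    (E : EtaleMod.{u, w} R) : IsDiscreteModule R (ModuleCat.of Rᵐᵒᵖ E.sections) := by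
  let _ : TopologicalSpace E.sections := ⊥
  have _ : DiscreteTopology E.sections := ⟨rfl⟩
  change Continuous fun z : E.sections × R => MulOpposite.op z.2 • z.1
  rw [continuous_iff_continuousAt]
  rintro ⟨s, r₀⟩
  simp only [ContinuousAt, nhds_prod_eq, nhds_discrete, Filter.tendsto_pure, Filter.pure_prod,
    Filter.eventually_map]
  have hs : Continuous fun x => (s.1 x).1 := s.2
  let act : E.total × R → E.total := fun z =>
    (MulOpposite.op z.2 • (⟨z.1, rfl⟩ : E.Fibre (E.proj z.1))).1
  have hact : Continuous act := E.str.continuous_smul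
  have hp : ∀ z, E.proj (act z) = E.proj z.1 := fun z =>
    (MulOpposite.op z.2 • (⟨z.1, rfl⟩ : E.Fibre (E.proj z.1))).2
  have hV : IsOpen {z : E.base × R | act ((s.1 z.1).1, z.2) = act ((s.1 z.1).1, r₀)} := by
    refine E.str.isLocalHomeomorph.isLocallyInjective.isOpen_eqLocus
      (g₁ := fun z : E.base × R => act ((s.1 z.1).1, z.2))
      (g₂ := fun z : E.base × R => act ((s.1 z.1).1, r₀)) ?_ ?_ ?_
    · exact hact.comp ((hs.comp continuous_fst).prodMk continuous_snd)
    · exact hact.comp ((hs.comp continuous_fst).prodMk continuous_const)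
    · funext z
      simp only [Function.comp, hp]
  have key : ∀ (r : R) (y z : E.base) (e : z = y) (a : E.total) (ha : E.proj a = y)
      (ha' : E.proj a = z), (MulOpposite.op r • (⟨a, ha⟩ : E.Fibre y)).1 =
        (MulOpposite.op r • (⟨a, ha'⟩ : E.Fibre z)).1 := by
    rintro r y z rfl a ha ha'
    rfl
  have hW : ∀ᶠ r in nhds r₀, ∀ x ∈ (Set.univ : Set E.base),
      act ((s.1 x).1, r) = act ((s.1 x).1, r₀) := by
    refine isCompact_univ.eventually_forall_of_forall_eventually fun x _ => ?_
    have : (x, r₀) ∈ {z : E.base × R | act ((s.1 z.1).1, z.2) = act ((s.1 z.1).1, r₀)} := rfl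
    exact (continuous_swap.tendsto (r₀, x)).eventually (hV.mem_nhds this)
  filter_upwards [hW] with r hr
  apply Subtype.ext
  funext x
  apply EtFibre.ext
  refine (key r _ _ (s.1 x).2 _ _ _).trans ((hr x trivial).trans (key r₀ _ _ (s.1 x).2 _ _ _).symm)

/-- The continuous product as a functor from étale spaces of `R`-modules to discrete
`R`-modules. -/
def contProd (R : Type w) [Ring R] [TopologicalSpace R] : EtaleMod.{u, w} R ⥤ DMod.{u, w} R where
  obj E := ⟨ModuleCat.of Rᵐᵒᵖ E.sections, E.sections_isDiscrete⟩
  map f := ObjectProperty.homMk (ModuleCat.ofHom (EtaleMod.sectionsMap f))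

section DirectedSystem

variable {R : Type w} [Ring R] [TopologicalSpace R] {I : Type u} [Preorder I]

/-- The inverse limit of the base spaces `X_i` of a directed system of étale spaces. -/
def BaseLim (F : I ⥤ EtaleMod.{u, w} R) : Type u :=
  {x : ∀ i, (F.obj i).base // ∀ (i j : I) (h : i ≤ j),
    EtaleMod.Hom.base (F.map (homOfLE h)) (x j) = x i}

instance (F : I ⥤ EtaleMod.{u, w} R) : TopologicalSpace (BaseLim F) :=
  instTopologicalSpaceSubtype

theorem BaseLim.isClosed (F : I ⥤ EtaleMod.{u, w} R) :
    IsClosed {x : ∀ i, (F.obj i).base | ∀ (i j : I) (h : i ≤ j),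
      EtaleMod.Hom.base (F.map (homOfLE h)) (x j) = x i} := by
  simp only [Set.ofPred_forall]
  refine isClosed_iInter fun i => isClosed_iInter fun j => isClosed_iInter fun h => ?_
  exact isClosed_eq ((map_continuous _).comp (continuous_apply j)) (continuous_apply i)

instance (F : I ⥤ EtaleMod.{u, w} R) : CompactSpace (BaseLim F) :=
  isCompact_iff_compactSpace.mp (BaseLim.isClosed F).isCompact

instance (F : I ⥤ EtaleMod.{u, w} R) : T2Space (BaseLim F) :=
  inferInstanceAs (T2Space {x : ∀ i, (F.obj i).base // ∀ (i j : I) (h : i ≤ j),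
    EtaleMod.Hom.base (F.map (homOfLE h)) (x j) = x i})

instance (F : I ⥤ EtaleMod.{u, w} R) : TotallyDisconnectedSpace (BaseLim F) :=
  inferInstanceAs (TotallyDisconnectedSpace {x : ∀ i, (F.obj i).base // ∀ (i j : I) (h : i ≤ j),
    EtaleMod.Hom.base (F.map (homOfLE h)) (x j) = x i})

/-- The projection of the inverse limit onto `X_i`. -/
def BaseLim.π (F : I ⥤ EtaleMod.{u, w} R) (i : I) : C(BaseLim F, (F.obj i).base) :=
  ⟨fun x => x.1 i, (continuous_apply i).comp continuous_subtype_val⟩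

/-- The disjoint union over all `i` of the pullbacks `A_i ×_{X_i} X`, where `X` is the inverse limit
of the `X_i`. -/
abbrev PreTotal (F : I ⥤ EtaleMod.{u, w} R) : Type u :=
  Σ i : I, {z : (F.obj i).total × BaseLim F // (F.obj i).proj z.1 = BaseLim.π F i z.2}

/-- For `i ≤ k` and a point `(a, x)` of `A_i ×_{X_i} X`, the image `φ_{ik}(a, x_k)` of `a`
in `A_k`. -/
def PreTotal.push {F : I ⥤ EtaleMod.{u, w} R} (z : PreTotal F) (k : I) (h : z.1 ≤ k) :
    (F.obj k).total :=
  (EtaleMod.Hom.fib (F.map (homOfLE h)) (BaseLim.π F k z.2.1.2)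
    ⟨z.2.1.1, z.2.2.trans (z.2.1.2.2 _ _ h).symm⟩).1

theorem PreTotal.push_push {F : I ⥤ EtaleMod.{u, w} R} (z z' : PreTotal F) (k l : I)
    (h : z.1 ≤ k) (h' : z'.1 ≤ k) (hl : k ≤ l) (hx : z.2.1.2 = z'.2.1.2)
    (e : z.push k h = z'.push k h') : z.push l (h.trans hl) = z'.push l (h'.trans hl) := by
  have key : ∀ (y : PreTotal F) (hy : y.1 ≤ k) (b : (F.obj k).total) (x : BaseLim F)
      (hb : (F.obj k).proj b = EtaleMod.Hom.base (F.map (homOfLE hl)) (BaseLim.π F l x)),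
      y.2.1.2 = x → y.push k hy = b → y.push l (hy.trans hl) =
        (EtaleMod.Hom.fib (F.map (homOfLE hl)) (BaseLim.π F l x) ⟨b, hb⟩).1 := by
    rintro ⟨i, ⟨⟨a, x⟩, ha⟩⟩ hy b _ hb rfl rfl
    have gen : ∀ (g g' : F.obj i ⟶ F.obj l) (_ : g = g') (t : (F.obj l).base)
        (p₁ : (F.obj i).proj a = EtaleMod.Hom.base g t)
        (p₂ : (F.obj i).proj a = EtaleMod.Hom.base g' t),
        (EtaleMod.Hom.fib g t ⟨a, p₁⟩).1 = (EtaleMod.Hom.fib g' t ⟨a, p₂⟩).1 := by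
      rintro g _ rfl t p₁ p₂
      rfl
    have ec : F.map (homOfLE (hy.trans hl)) = F.map (homOfLE hy) ≫ F.map (homOfLE hl) := by
      rw [← F.map_comp]
      rfl
    refine (gen _ _ ec (BaseLim.π F l x) (ha.trans (x.2 _ _ (hy.trans hl)).symm) ?_).trans ?_
    · exact (ha.trans (x.2 _ _ (hy.trans hl)).symm).trans (by rw [ec]; rfl)
    · have gen2 : ∀ (t t' : (F.obj k).base) (_ : t = t')
          (p₁ : (F.obj i).proj a = EtaleMod.Hom.base (F.map (homOfLE hy)) t)
          (p₂ : (F.obj i).proj a = EtaleMod.Hom.base (F.map (homOfLE hy)) t')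
          (q₁ : (F.obj k).proj (EtaleMod.Hom.fib (F.map (homOfLE hy)) t ⟨a, p₁⟩).1 =
            EtaleMod.Hom.base (F.map (homOfLE hl)) (BaseLim.π F l x))
          (q₂ : (F.obj k).proj (EtaleMod.Hom.fib (F.map (homOfLE hy)) t' ⟨a, p₂⟩).1 =
            EtaleMod.Hom.base (F.map (homOfLE hl)) (BaseLim.π F l x)),
          (EtaleMod.Hom.fib (F.map (homOfLE hl)) (BaseLim.π F l x) ⟨_, q₁⟩).1 =
            (EtaleMod.Hom.fib (F.map (homOfLE hl)) (BaseLim.π F l x) ⟨_, q₂⟩).1 := by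
        rintro t _ rfl p₁ p₂ q₁ q₂
        rfl
      exact gen2 _ _ (x.2 _ _ hl) _ _ (EtaleMod.Hom.fib (F.map (homOfLE hy)) _ _).2 _
  have hb : (F.obj k).proj (z.push k h) =
      EtaleMod.Hom.base (F.map (homOfLE hl)) (BaseLim.π F l z.2.1.2) :=
    (EtaleMod.Hom.fib (F.map (homOfLE h)) _ _).2.trans (z.2.1.2.2 _ _ hl).symm
  rw [key z h _ z.2.1.2 hb rfl rfl, key z' h' _ z.2.1.2 hb hx.symm e.symm]

/-- Two points of the disjoint union are identified when they lie over the same point of the inverse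
limit and become equal at some later stage. -/
instance PreTotal.setoid [IsDirectedOrder I] (F : I ⥤ EtaleMod.{u, w} R) :
    Setoid (PreTotal F) where
  r z z' := z.2.1.2 = z'.2.1.2 ∧ ∃ (k : I) (h : z.1 ≤ k) (h' : z'.1 ≤ k),
    z.push k h = z'.push k h'
  iseqv := by
    refine ⟨fun z => ⟨rfl, z.1, le_rfl, le_rfl, rfl⟩, ?_, ?_⟩
    · rintro z z' ⟨hx, k, h, h', e⟩
      exact ⟨hx.symm, k, h', h, e.symm⟩
    · rintro z z' z'' ⟨hx, k, h, h', e⟩ ⟨hx', l, g, g', e'⟩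
      obtain ⟨m, hk, hl⟩ := exists_ge_ge k l
      exact ⟨hx.trans hx', m, h.trans hk, g'.trans hl,
        (PreTotal.push_push z z' k m h h' hk hx e).trans
          (PreTotal.push_push z' z'' l m g g' hl hx' e')⟩

variable [IsDirectedOrder I]

/-- The total space of the direct limit: the direct limit of the spaces `A_i ×_{X_i} X` with the
direct limit (quotient) topology. Its fibre over `x = (x_i)` is the direct limit of the fibres
of `A_i` over `x_i`. -/
def TotalLim (F : I ⥤ EtaleMod.{u, w} R) : Type u := Quotient (PreTotal.setoid F)

instance (F : I ⥤ EtaleMod.{u, w} R) : TopologicalSpace (TotalLim F) :=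
  inferInstanceAs (TopologicalSpace (Quotient (PreTotal.setoid F)))

/-- The projection of the direct limit of the `A_i` to the inverse limit of the `X_i`. -/
def TotalLim.proj (F : I ⥤ EtaleMod.{u, w} R) : TotalLim F → BaseLim F :=
  Quotient.lift (fun z => z.2.1.2) fun _ _ h => h.1

/-- The canonical map `A_i ×_{X_i} X → lim A_j`, on the fibre over `x`. -/
def TotalLim.mk (F : I ⥤ EtaleMod.{u, w} R) (i : I) (x : BaseLim F)
    (a : (F.obj i).Fibre (BaseLim.π F i x)) : TotalLim F :=
  Quotient.mk (PreTotal.setoid F) ⟨i, ⟨(a.1, x), a.2⟩⟩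

/-- The direct limit as an étale space of `R`-modules, given the structure of one on its
projection. -/
def directLimit (F : I ⥤ EtaleMod.{u, w} R) (S : EtaleModStr R (TotalLim.proj F)) :
    EtaleMod.{u, w} R where
  base := Profinite.of (BaseLim F)
  total := TotalLim F
  proj := TotalLim.proj F
  str := S

end DirectedSystem

/-!
The fibre of the direct limit over a point `x = (x_i)` is the direct limit of the fibres of the
`A_i` over the `x_i`, which gives its module structure. The maps `A_i ×_{X_i} X → A_j ×_{X_j} X`
are maps of local homeomorphisms over `X`, hence open; so the canonical maps from the
`A_i ×_{X_i} X` to the direct limit are open too, and everything about its topology can be checked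
on the stages.

Sections over a profinite base are flexible: they can be glued along clopen sets, and there is one
through every point. A set of sections that is stable under gluing and meets every point of every
fibre therefore contains every section, by compactness. Clopen subsets of `X` come from some `X_i`,
so this applies to the sections of the direct limit that come from some stage. Conversely, the sets
on which the images of a section `s` in the later stages vanish are open and compatible with the
transition maps. If none of them were a whole `X_k`, their complements would be an inverse system of
nonempty compact spaces, and a point of its limit would be a point of `X` at which `s` does not
vanish in the direct limit.
-/

open Topology EtaleMod

section Topology

variable {A X Y : Type*} [TopologicalSpace A] [TopologicalSpace X] [TopologicalSpace Y]

theorem isLocalHomeomorph_of_isLocallyInjective {p : A → X} (hp : Continuous p)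
    (hpo : IsOpenMap p) (hpi : IsLocallyInjective p) : IsLocalHomeomorph p := by
  refine isLocalHomeomorph_iff_isOpenEmbedding_restrict.2 fun a => ?_
  obtain ⟨U, hU, ha, hinj⟩ := hpi a
  exact ⟨U, hU.mem_nhds ha, .of_continuous_injective_isOpenMap
    (hp.comp continuous_subtype_val) hinj.injective (hpo.domRestrict hU)⟩

theorem isOpenMap_pullback_snd {p : A → X} (hp : IsOpenMap p) {f : Y → X} (hf : Continuous f) :
    IsOpenMap fun z : p.Pullback f => z.1.2 := by
  have hgraph : IsOpenMap fun w : {w : X × Y // w.1 = f w.2} => w.1.2 :=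
    .of_inverse (f' := fun y => ⟨(f y, y), rfl⟩) (by fun_prop) (fun _ => rfl)
      fun w => Subtype.ext (Prod.ext w.2.symm rfl)
  exact hgraph.comp ((hp.prodMap .id).restrictPreimage {w | w.1 = f w.2})

theorem isLocalHomeomorph_pullback_snd {p : A → X} (hp : IsLocalHomeomorph p) {f : Y → X}
    (hf : Continuous f) : IsLocalHomeomorph fun z : p.Pullback f => z.1.2 := by
  refine isLocalHomeomorph_of_isLocallyInjective (by fun_prop)
    (isOpenMap_pullback_snd hp.isOpenMap hf) fun z => ?_
  obtain ⟨U, hU, hzU, hinj⟩ := hp.isLocallyInjective z.1.1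
  refine ⟨{w | w.1.1 ∈ U}, hU.preimage (by fun_prop), hzU,
    fun v hv w hw e => Subtype.ext (Prod.ext (hinj hv hw ?_) e)⟩
  rw [v.2, w.2]
  exact congrArg f e

theorem isOpenMap_pullbackMap {A' B B' X : Type*} [TopologicalSpace A'] [TopologicalSpace B]
    [TopologicalSpace B'] {p : A → X} {q : B → X} {f : A' → A} {g : B' → B}
    (hf : IsOpenMap f) (hg : IsOpenMap g) :
    IsOpenMap fun z : (p ∘ f).Pullback (q ∘ g) =>
      (⟨(f z.1.1, g z.1.2), z.2⟩ : p.Pullback q) :=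
  (hf.prodMap hg).restrictPreimage {z | p z.1 = q z.2}

variable {ι : Type*} {V : ι → Type*} [∀ i, TopologicalSpace (V i)] {g : ∀ i, V i → A}

theorem continuous_of_isOpenMap_cover (hg : ∀ i, IsOpenMap (g i)) (hs : ∀ a, ∃ i v, g i v = a)
    {f : A → X} (hf : ∀ i, Continuous (f ∘ g i)) : Continuous f := by
  refine continuous_iff_continuousAt.2 fun a => ?_
  obtain ⟨i, v, rfl⟩ := hs a
  exact (Filter.map_mono ((hg i).nhds_le v)).trans ((hf i).tendsto v)

theorem isOpenMap_of_cover (hgc : ∀ i, Continuous (g i)) (hs : ∀ a, ∃ i v, g i v = a)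
    {p : A → X} (hp : ∀ i, IsOpenMap (p ∘ g i)) : IsOpenMap p := by
  refine IsOpenMap.of_nhds_le fun a => ?_
  obtain ⟨i, v, rfl⟩ := hs a
  exact ((hp i).nhds_le v).trans (Filter.map_mono (m := p) (hgc i).continuousAt)

theorem isLocalHomeomorph_of_isOpenMap_cover (hgc : ∀ i, Continuous (g i))
    (hg : ∀ i, IsOpenMap (g i)) (hs : ∀ a, ∃ i v, g i v = a)
    {p : A → X} (hp : ∀ i, IsLocalHomeomorph (p ∘ g i)) : IsLocalHomeomorph p := by
  refine isLocalHomeomorph_of_isLocallyInjective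
    (continuous_of_isOpenMap_cover hg hs fun i => (hp i).continuous)
    (isOpenMap_of_cover hgc hs fun i => (hp i).isOpenMap) fun a => ?_
  obtain ⟨i, v, rfl⟩ := hs a
  obtain ⟨U, hU, hvU, hinj⟩ := (hp i).isLocallyInjective v
  exact ⟨g i '' U, hg i U hU, ⟨v, hvU, rfl⟩, Set.InjOn.image_of_comp hinj⟩

end Topology

theorem nonempty_isColimit_of_forall_exists {S : Type*} [Ring S] {I : Type u} [Preorder I]
    [IsDirectedOrder I] [Nonempty I] {G : I ⥤ ModuleCat.{u} S} (c : Cocone G)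
    (hsurj : ∀ m : c.pt, ∃ i, ∃ a : G.obj i, (c.ι.app i).hom a = m)
    (hinj : ∀ i, ∀ a : G.obj i, (c.ι.app i).hom a = 0 →
      ∃ (k : I) (h : i ≤ k), (G.map (homOfLE h)).hom a = 0) : Nonempty (IsColimit c) := by
  classical
  let f (i j : I) (h : i ≤ j) := (G.map (homOfLE h)).hom
  have : DirectedSystem (fun i => G.obj i) (fun i j h => f i j h) :=
    { map_self := fun i x => congrArg (fun f : G.obj i ⟶ G.obj i => f.hom x) (G.map_id i)
      map_map := fun k j i h h' x =>
        congrArg (fun f : G.obj i ⟶ G.obj k => f.hom x)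
        (G.map_comp (homOfLE h) (homOfLE h')).symm }
  let hlim : IsColimit (ModuleCat.directLimitCocone (fun i => G.obj i) f : Cocone G) :=
    ModuleCat.directLimitIsColimit _ _
  have hdesc (i) (a : G.obj i) :
      (hlim.desc c).hom (Module.DirectLimit.of S I _ f i a) = (c.ι.app i).hom a :=
    congrArg (fun f : G.obj i ⟶ c.pt => f.hom a) (hlim.fac c i)
  have : IsIso (hlim.desc c) := by
    rw [ConcreteCategory.isIso_iff_bijective]
    refine ⟨(injective_iff_map_eq_zero (hlim.desc c).hom).2 fun z hz => ?_, fun m => ?_⟩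
    · obtain ⟨i, a, rfl⟩ := Module.DirectLimit.exists_of z
      obtain ⟨k, h, hk⟩ := hinj i a ((hdesc i a).symm.trans hz)
      exact (Module.DirectLimit.of_f (hij := h)).symm.trans ((congrArg _ hk).trans (map_zero _))
    · obtain ⟨i, a, rfl⟩ := hsurj m
      exact ⟨_, hdesc i a⟩
  exact ⟨hlim.ofPointIso⟩

namespace EtaleMod

variable {R : Type w} [Ring R] [TopologicalSpace R]

/-- The identification of the fibres over two equal points. -/
def fibreCast (E : EtaleMod.{u, w} R) {x y : E.base} (h : x = y) :
    E.Fibre x →ₗ[Rᵐᵒᵖ] E.Fibre y where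
  toFun a := ⟨a.1, a.2.trans h⟩
  map_add' a b := by subst h; rfl
  map_smul' r a := by subst h; rfl

theorem Hom.fib_congr {E F : EtaleMod.{u, w} R} {f g : E ⟶ F} (h : f = g) {y z : F.base}
    (hyz : y = z) {a : E.Fibre (Hom.base f y)} {b : E.Fibre (Hom.base g z)} (hab : a.1 = b.1) :
    (Hom.fib f y a).1 = (Hom.fib g z b).1 := by
  subst h hyz
  rw [EtFibre.ext hab]

theorem Hom.ext_val {E F : EtaleMod.{u, w} R} {f g : E ⟶ F}
    (hb : ∀ y, Hom.base f y = Hom.base g y)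
    (h : ∀ y (a : E.Fibre (Hom.base f y)) (b : E.Fibre (Hom.base g y)), a.1 = b.1 →
      (Hom.fib f y a).1 = (Hom.fib g y b).1) : f = g := by
  obtain ⟨fb, ff, _⟩ := f
  obtain ⟨gb, gf, _⟩ := g
  obtain rfl : fb = gb := ContinuousMap.ext hb
  obtain rfl : ff = gf := funext fun y => LinearMap.ext fun a => EtFibre.ext (h y a a rfl)
  rfl

variable {W : Type*} [TopologicalSpace W]

theorem continuous_add_fibre (E : EtaleMod.{u, w} R) {b : W → E.base} {s t : ∀ v, E.Fibre (b v)}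
    (hs : Continuous fun v => (s v).1) (ht : Continuous fun v => (t v).1) :
    Continuous fun v => (s v + t v).1 := by
  refine (E.str.continuous_add.comp
    ((hs.prodMk ht).subtype_mk fun v => (s v).2.trans (t v).2.symm)).congr fun v => ?_
  exact congrArg EtFibre.val (map_add (E.fibreCast (t v).2) ⟨(s v).1, _⟩ ⟨(t v).1, rfl⟩)

theorem continuous_smul_fibre (E : EtaleMod.{u, w} R) {b : W → E.base} {r : W → R}
    {s : ∀ v, E.Fibre (b v)} (hr : Continuous r) (hs : Continuous fun v => (s v).1) :
    Continuous fun v => (MulOpposite.op (r v) • s v).1 := by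
  refine (E.str.continuous_smul.comp (hs.prodMk hr)).congr fun v => ?_
  exact congrArg EtFibre.val
    (map_smul (E.fibreCast (s v).2) (MulOpposite.op (r v)) ⟨(s v).1, rfl⟩)

theorem Hom.continuous_fib_comp {E F : EtaleMod.{u, w} R} (f : E ⟶ F) {b : W → F.base}
    {s : ∀ v, E.Fibre (Hom.base f (b v))} (hb : Continuous b)
    (hs : Continuous fun v => (s v).1) : Continuous fun v => (Hom.fib f (b v) (s v)).1 :=
  (Hom.continuous_fib f).comp ((hs.prodMk hb).subtype_mk fun v => (s v).2)

end EtaleMod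

section Stages

variable {R : Type w} [Ring R] [TopologicalSpace R] {I : Type u} [Preorder I]
  (F : I ⥤ EtaleMod.{u, w} R)

/-- The map `φ_{ij}` on the fibres over a point of the inverse limit. -/
def fibreTransition (x : BaseLim F) (i j : I) (h : i ≤ j) :
    (F.obj i).Fibre (BaseLim.π F i x) →ₗ[Rᵐᵒᵖ] (F.obj j).Fibre (BaseLim.π F j x) :=
  (Hom.fib (F.map (homOfLE h)) (BaseLim.π F j x)).comp
    ((F.obj i).fibreCast (x.2 i j h).symm)

instance (x : BaseLim F) : DirectedSystem (fun i => (F.obj i).Fibre (BaseLim.π F i x))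
    (fun i j h => fibreTransition F x i j h) where
  map_self i a := EtFibre.ext (Hom.fib_congr (b := a) (F.map_id i) rfl rfl)
  map_map k j i h h' a := by
    have hcomp : F.map (homOfLE (h.trans h')) = F.map (homOfLE h) ≫ F.map (homOfLE h') :=
      F.map_comp (homOfLE h) (homOfLE h')
    have ha : (F.obj i).proj a.1 =
        Hom.base (F.map (homOfLE h) ≫ F.map (homOfLE h')) (BaseLim.π F k x) :=
      (a.2.trans (x.2 i k _).symm).trans (by rw [hcomp]; rfl)
    exact EtFibre.ext ((Hom.fib_congr rfl rfl (Hom.fib_congr rfl (x.2 j k h').symm rfl)).trans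
      (Hom.fib_congr (a := ⟨a.1, ha⟩) hcomp.symm rfl rfl))

/-- The pullback `A_i ×_{X_i} X` of a stage of the system to the inverse limit of the bases. -/
abbrev Stage (i : I) : Type u :=
  (F.obj i).proj.Pullback (BaseLim.π F i)

namespace Stage

theorem isLocalHomeomorph_snd (i : I) : IsLocalHomeomorph fun z : Stage F i => z.1.2 :=
  isLocalHomeomorph_pullback_snd (F.obj i).str.isLocalHomeomorph (map_continuous (BaseLim.π F i))

variable {i j : I} (h : i ≤ j)

/-- The map `(a, x) ↦ (φ_{ij}(a, x_j), x)` from `A_i ×_{X_i} X` to `A_j ×_{X_j} X`. -/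
def transition (z : Stage F i) : Stage F j :=
  ⟨((fibreTransition F z.1.2 i j h ⟨z.1.1, z.2⟩).1, z.1.2),
    (fibreTransition F z.1.2 i j h ⟨z.1.1, z.2⟩).2⟩

theorem continuous_transition : Continuous (transition F h) :=
  Continuous.subtype_mk (.prodMk (Hom.continuous_fib_comp (F.map (homOfLE h))
    (b := fun z : Stage F i => BaseLim.π F j z.1.2) (by fun_prop)
    (continuous_fst.comp continuous_subtype_val)) (by fun_prop)) _

theorem isOpenMap_transition : IsOpenMap (transition F h) :=
  (IsLocalHomeomorph.of_comp (g := fun z : Stage F j => z.1.2) (isLocalHomeomorph_snd F i)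
    (isLocalHomeomorph_snd F j) (continuous_transition F h)).isOpenMap

variable [IsDirectedOrder I] (i)

/-- The canonical map `A_i ×_{X_i} X → lim A_j`. -/
def toTotalLim (z : Stage F i) : TotalLim F :=
  TotalLim.mk F i z.1.2 ⟨z.1.1, z.2⟩

variable {i}

theorem toTotalLim_eq_iff (z : Stage F i) (z' : Stage F j) :
    toTotalLim F i z = toTotalLim F j z' ↔
      ∃ (k : I) (h : i ≤ k) (h' : j ≤ k), transition F h z = transition F h' z' := by
  refine Quotient.eq.trans ⟨?_, ?_⟩
  · rintro ⟨hx, k, h, h', e⟩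
    exact ⟨k, h, h', Subtype.ext (Prod.ext e hx)⟩
  · rintro ⟨k, h, h', e⟩
    exact ⟨congrArg (fun z => z.1.2) e, k, h, h', congrArg (fun z => z.1.1) e⟩

theorem toTotalLim_transition (z : Stage F i) :
    toTotalLim F j (transition F h z) = toTotalLim F i z :=
  (toTotalLim_eq_iff F _ _).2 ⟨j, le_rfl, h, Subtype.ext (Prod.ext (congrArg EtFibre.val
    (DirectedSystem.map_self' (fun i j h => fibreTransition F z.1.2 i j h) _)) rfl)⟩

theorem exists_toTotalLim_eq (t : TotalLim F) : ∃ (i : I) (z : Stage F i), toTotalLim F i z = t :=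
  let ⟨⟨i, z⟩, hz⟩ := Quotient.mk_surjective t
  ⟨i, z, hz⟩

theorem exists_toTotalLim_eq₂ (t t' : TotalLim F) :
    ∃ (i : I) (z z' : Stage F i), toTotalLim F i z = t ∧ toTotalLim F i z' = t' := by
  obtain ⟨i, z, rfl⟩ := exists_toTotalLim_eq F t
  obtain ⟨j, z', rfl⟩ := exists_toTotalLim_eq F t'
  obtain ⟨k, h, h'⟩ := exists_ge_ge i j
  exact ⟨k, _, _, toTotalLim_transition F h z, toTotalLim_transition F h' z'⟩

variable (i)

theorem continuous_toTotalLim : Continuous (toTotalLim F i) :=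
  continuous_quotient_mk'.comp (continuous_sigmaMk (σ := Stage F))

theorem isOpenMap_toTotalLim : IsOpenMap (toTotalLim F i) := by
  intro W hW
  refine isOpen_coinduced.2 (isOpen_sigma_iff.2 fun j => ?_)
  have hpre : toTotalLim F j ⁻¹' (toTotalLim F i '' W) =
      ⋃ (k : I) (h : i ≤ k) (h' : j ≤ k), transition F h' ⁻¹' (transition F h '' W) := by
    ext z
    simp only [Set.mem_preimage, Set.mem_image, Set.mem_iUnion, toTotalLim_eq_iff]
    exact ⟨fun ⟨y, hy, k, h, h', e⟩ => ⟨k, h, h', y, hy, e⟩,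
      fun ⟨k, h, h', y, hy, e⟩ => ⟨y, hy, k, h, h', e⟩⟩
  refine (congrArg IsOpen hpre).mpr ?_
  exact isOpen_iUnion fun k => isOpen_iUnion fun h => isOpen_iUnion fun h' =>
    (isOpenMap_transition F h W hW).preimage (continuous_transition F h')

end Stage

open Stage

theorem TotalLim.isLocalHomeomorph_proj [IsDirectedOrder I] :
    IsLocalHomeomorph (TotalLim.proj F) :=
  isLocalHomeomorph_of_isOpenMap_cover (fun i => continuous_toTotalLim F i)
    (fun i => isOpenMap_toTotalLim F i) (exists_toTotalLim_eq F) (isLocalHomeomorph_snd F)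

end Stages

section Fibres

variable {R : Type w} [Ring R] [TopologicalSpace R] {I : Type u} [Preorder I] [IsDirectedOrder I]
  (F : I ⥤ EtaleMod.{u, w} R) (x : BaseLim F)

namespace TotalLim

theorem mk_eq_mk_iff {i j : I} (a : (F.obj i).Fibre (BaseLim.π F i x))
    (b : (F.obj j).Fibre (BaseLim.π F j x)) :
    TotalLim.mk F i x a = TotalLim.mk F j x b ↔ ∃ (k : I) (h : i ≤ k) (h' : j ≤ k),
      fibreTransition F x i k h a = fibreTransition F x j k h' b := by
  refine (Stage.toTotalLim_eq_iff F ⟨(a.1, x), a.2⟩ ⟨(b.1, x), b.2⟩).trans ?_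
  refine exists_congr fun k => exists_congr fun h => exists_congr fun h' => ?_
  exact ⟨fun e => EtFibre.ext (congrArg (fun z => z.1.1) e), fun e =>
    Subtype.ext (Prod.ext (congrArg EtFibre.val e) rfl)⟩

/-- The fibre of the direct limit over `x` is the direct limit of the fibres over `x_i`. -/
noncomputable def fibreEquiv :
    DirectLimit (fun i => (F.obj i).Fibre (BaseLim.π F i x))
      (fun i j h => fibreTransition F x i j h) ≃ EtFibre (TotalLim.proj F) x :=
  Equiv.ofBijective
    (DirectLimit.lift _ (fun i a => ⟨TotalLim.mk F i x a, rfl⟩) fun i j h a =>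
      EtFibre.ext (Stage.toTotalLim_transition F h ⟨(a.1, x), a.2⟩).symm) <| by
    constructor
    · rintro ⟨i, a⟩ ⟨j, b⟩ e
      exact Quotient.sound ((mk_eq_mk_iff F x a b).1 (congrArg EtFibre.val e))
    · rintro ⟨t, rfl⟩
      obtain ⟨i, z, rfl⟩ := Stage.exists_toTotalLim_eq F t
      exact ⟨Quotient.mk _ ⟨i, ⟨z.1.1, z.2⟩⟩, rfl⟩

variable [Nonempty I]

noncomputable instance : AddCommGroup (EtFibre (TotalLim.proj F) x) :=
  (fibreEquiv F x).symm.addCommGroup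

noncomputable instance : Module Rᵐᵒᵖ (EtFibre (TotalLim.proj F) x) :=
  (fibreEquiv F x).symm.module Rᵐᵒᵖ

/-- The canonical linear map from the fibre of `A_i` over `x_i` to the fibre of the direct limit
over `x`. -/
noncomputable def fibreMk (i : I) :
    (F.obj i).Fibre (BaseLim.π F i x) →ₗ[Rᵐᵒᵖ] EtFibre (TotalLim.proj F) x :=
  ((fibreEquiv F x).symm.linearEquiv Rᵐᵒᵖ).symm.toLinearMap ∘ₗ
    DirectLimit.Module.of Rᵐᵒᵖ I _ (fun i j h => fibreTransition F x i j h) i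

theorem fibreMk_transition {i j : I} (h : i ≤ j) (a : (F.obj i).Fibre (BaseLim.π F i x)) :
    fibreMk F x j (fibreTransition F x i j h a) = fibreMk F x i a :=
  EtFibre.ext (Stage.toTotalLim_transition F h ⟨(a.1, x), a.2⟩)

theorem exists_fibreMk_eq (t : EtFibre (TotalLim.proj F) x) : ∃ i a, fibreMk F x i a = t := by
  obtain ⟨t, rfl⟩ := t
  obtain ⟨i, z, rfl⟩ := Stage.exists_toTotalLim_eq F t
  exact ⟨i, ⟨z.1.1, z.2⟩, rfl⟩

section Desc

variable {P : Type*} [AddCommGroup P] [Module Rᵐᵒᵖ P]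
  (g : ∀ i, (F.obj i).Fibre (BaseLim.π F i x) →ₗ[Rᵐᵒᵖ] P)
  (hg : ∀ i j h a, g j (fibreTransition F x i j h a) = g i a)

/-- The linear map on a fibre of the direct limit given by compatible linear maps on the fibres of
the system. -/
noncomputable def fibreDesc : EtFibre (TotalLim.proj F) x →ₗ[Rᵐᵒᵖ] P :=
  DirectLimit.Module.lift Rᵐᵒᵖ I _ (fun i j h => fibreTransition F x i j h) g hg ∘ₗ
    ((fibreEquiv F x).symm.linearEquiv Rᵐᵒᵖ).toLinearMap

theorem fibreDesc_fibreMk (i : I) (a : (F.obj i).Fibre (BaseLim.π F i x)) :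
    fibreDesc F x g hg (fibreMk F x i a) = g i a :=
  congrArg (DirectLimit.Module.lift Rᵐᵒᵖ I _ (fun i j h => fibreTransition F x i j h) g hg)
    ((fibreEquiv F x).symm_apply_apply (Quotient.mk _ ⟨i, a⟩))

end Desc

end TotalLim

end Fibres

section Cocones

variable {R : Type w} [Ring R] [TopologicalSpace R] {I : Type u} [Preorder I]
  (F : I ⥤ EtaleMod.{u, w} R)

/-- The map of bases induced by a cocone. -/
def baseDesc (s : Cocone F) : C(s.pt.base, BaseLim F) where
  toFun y := ⟨fun i => Hom.base (s.ι.app i) y, fun i _ h =>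
    congrArg (fun f : F.obj i ⟶ s.pt => Hom.base f y) (s.w (homOfLE h))⟩
  continuous_toFun := (continuous_pi fun i => map_continuous (Hom.base (s.ι.app i))).subtype_mk _

theorem cocone_fib_fibreTransition (s : Cocone F) (y : s.pt.base) (i j : I) (h : i ≤ j)
    (a : (F.obj i).Fibre (BaseLim.π F i (baseDesc F s y))) :
    Hom.fib (s.ι.app j) y (fibreTransition F (baseDesc F s y) i j h a) =
      Hom.fib (s.ι.app i) y a :=
  EtFibre.ext (Hom.fib_congr (f := F.map (homOfLE h) ≫ s.ι.app j) (s.w (homOfLE h)) rfl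
    (a := ⟨a.1, a.2.trans ((baseDesc F s y).2 i j h).symm⟩) (b := a) rfl)

end Cocones

section DirectLimit

variable {R : Type w} [Ring R] [TopologicalSpace R] {I : Type u} [Preorder I] [IsDirectedOrder I]
  [Nonempty I] (F : I ⥤ EtaleMod.{u, w} R)

namespace TotalLim

theorem continuous_fibreMk (i : I) {W : Type*} [TopologicalSpace W] {b : W → BaseLim F}
    {s : ∀ v, (F.obj i).Fibre (BaseLim.π F i (b v))} (hb : Continuous b)
    (hs : Continuous fun v => (s v).1) : Continuous fun v => (fibreMk F (b v) i (s v)).1 :=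
  (Stage.continuous_toTotalLim F i).comp ((hs.prodMk hb).subtype_mk fun v => (s v).2)

theorem continuous_zero : Continuous fun x => (0 : EtFibre (TotalLim.proj F) x).1 := by
  obtain ⟨i⟩ := ‹Nonempty I›
  exact (continuous_fibreMk F i (s := fun _ => 0) continuous_id
    ((F.obj i).str.continuous_zero.comp (map_continuous (BaseLim.π F i)))).congr fun x =>
      congrArg EtFibre.val (map_zero (fibreMk F x i))

theorem continuous_add : Continuous fun z : (TotalLim.proj F).Pullback (TotalLim.proj F) =>
    ((⟨z.1.1, z.2⟩ : EtFibre (TotalLim.proj F) (TotalLim.proj F z.1.2)) + ⟨z.1.2, rfl⟩).1 := by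
  refine continuous_of_isOpenMap_cover (fun i => isOpenMap_pullbackMap
    (Stage.isOpenMap_toTotalLim F i) (Stage.isOpenMap_toTotalLim F i)) ?_ fun i => ?_
  · rintro ⟨⟨t, t'⟩, h⟩
    obtain ⟨i, z, z', rfl, rfl⟩ := Stage.exists_toTotalLim_eq₂ F t t'
    exact ⟨i, ⟨(z, z'), h⟩, rfl⟩
  · have hx (z : (TotalLim.proj F ∘ Stage.toTotalLim F i).Pullback
        (TotalLim.proj F ∘ Stage.toTotalLim F i)) : z.1.1.1.2 = z.1.2.1.2 := z.2
    refine (continuous_fibreMk F i ((continuous_snd.comp continuous_subtype_val).comp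
      (continuous_snd.comp continuous_subtype_val)) ((F.obj i).continuous_add_fibre
        (s := fun z => ⟨z.1.1.1.1, z.1.1.2.trans (congrArg _ (hx z))⟩)
        (t := fun z => ⟨z.1.2.1.1, z.1.2.2⟩) (by fun_prop) (by fun_prop))).congr ?_
    rintro ⟨⟨⟨⟨a, x⟩, ha⟩, ⟨⟨b, y⟩, hb⟩⟩, h⟩
    obtain rfl : x = y := h
    exact congrArg EtFibre.val (map_add (fibreMk F x i) ⟨a, ha⟩ ⟨b, hb⟩)

theorem continuous_smul : Continuous fun z : TotalLim F × R =>
    (MulOpposite.op z.2 • (⟨z.1, rfl⟩ : EtFibre (TotalLim.proj F) (TotalLim.proj F z.1))).1 := by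
  refine continuous_of_isOpenMap_cover (fun i => (Stage.isOpenMap_toTotalLim F i).prodMap .id)
    ?_ fun i => ?_
  · rintro ⟨t, r⟩
    obtain ⟨i, z, rfl⟩ := Stage.exists_toTotalLim_eq F t
    exact ⟨i, (z, r), rfl⟩
  · exact (continuous_fibreMk F i ((continuous_snd.comp continuous_subtype_val).comp continuous_fst)
      ((F.obj i).continuous_smul_fibre (s := fun z : Stage F i × R => ⟨z.1.1.1, z.1.2⟩)
        continuous_snd (by fun_prop))).congr fun z =>
      congrArg EtFibre.val (map_smul (fibreMk F z.1.1.2 i) (MulOpposite.op z.2) ⟨z.1.1.1, z.1.2⟩)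

end TotalLim

open TotalLim

/-- The étale space structure on the projection of the direct limit. -/
noncomputable def directLimitStr : EtaleModStr R (TotalLim.proj F) where
  isLocalHomeomorph := TotalLim.isLocalHomeomorph_proj F
  continuous_zero := TotalLim.continuous_zero F
  continuous_add := TotalLim.continuous_add F
  continuous_smul := TotalLim.continuous_smul F

/-- The canonical morphisms from the `A_i` to the direct limit. -/
noncomputable def directLimitι :
    F ⟶ (Functor.const I).obj (directLimit F (directLimitStr F)) where
  app i :=
    { base := BaseLim.π F i
      fib := fun x => fibreMk F x i
      continuous_fib := Stage.continuous_toTotalLim F i }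
  naturality i j f := by
    refine Hom.ext_val (fun x => x.2 i j (leOfHom f)) fun x a b hab => ?_
    obtain rfl : a = ⟨b.1, b.2.trans (x.2 i j (leOfHom f)).symm⟩ := EtFibre.ext hab
    exact congrArg EtFibre.val (fibreMk_transition F x (leOfHom f) b)

/-- The linear map from the fibre of the direct limit over the image of `y` to the fibre over `y`
of the point of a cocone. -/
noncomputable def fibreDescOfCocone (s : Cocone F) (y : s.pt.base) :
    EtFibre (TotalLim.proj F) (baseDesc F s y) →ₗ[Rᵐᵒᵖ] s.pt.Fibre y :=
  fibreDesc F (baseDesc F s y) (fun i => Hom.fib (s.ι.app i) y) (cocone_fib_fibreTransition F s y)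

theorem fibreDescOfCocone_fibreMk (s : Cocone F) (y : s.pt.base) (i : I)
    (a : (F.obj i).Fibre (BaseLim.π F i (baseDesc F s y))) :
    fibreDescOfCocone F s y (fibreMk F (baseDesc F s y) i a) = Hom.fib (s.ι.app i) y a :=
  fibreDesc_fibreMk F (baseDesc F s y) _ _ i a

/-- The morphism from the direct limit induced by a cocone. -/
noncomputable def directLimitDesc (s : Cocone F) :
    directLimit F (directLimitStr F) ⟶ s.pt where
  base := baseDesc F s
  fib := fibreDescOfCocone F s
  continuous_fib := by
    refine continuous_of_isOpenMap_cover (fun i => isOpenMap_pullbackMap (p := TotalLim.proj F)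
      (q := baseDesc F s) (Stage.isOpenMap_toTotalLim F i) .id) ?_ fun i => ?_
    · rintro ⟨⟨t, y⟩, h⟩
      obtain ⟨i, z, rfl⟩ := Stage.exists_toTotalLim_eq F t
      exact ⟨i, ⟨(z, y), h⟩, rfl⟩
    · have hx (z : (TotalLim.proj F ∘ Stage.toTotalLim F i).Pullback (baseDesc F s)) :
          z.1.1.1.2 = baseDesc F s z.1.2 := z.2
      refine (Hom.continuous_fib_comp (s.ι.app i) (continuous_snd.comp continuous_subtype_val)
        (s := fun z => ⟨z.1.1.1.1, z.1.1.2.trans (congrArg _ (hx z))⟩) (by fun_prop)).congr ?_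
      rintro ⟨⟨⟨⟨a, x⟩, ha⟩, y⟩, h⟩
      obtain rfl : x = baseDesc F s y := h
      exact congrArg EtFibre.val (fibreDescOfCocone_fibreMk F s y i ⟨a, ha⟩).symm

theorem directLimitι_app_comp_directLimitDesc (s : Cocone F) (i : I) :
    (directLimitι F).app i ≫ directLimitDesc F s = s.ι.app i := by
  refine Hom.ext_val (fun y => rfl) fun y a b hab => ?_
  obtain rfl : a = b := EtFibre.ext hab
  exact congrArg EtFibre.val (fibreDescOfCocone_fibreMk F s y i a)

theorem hom_ext_of_directLimitι {E : EtaleMod.{u, w} R}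
    {m n : directLimit F (directLimitStr F) ⟶ E}
    (h : ∀ i, (directLimitι F).app i ≫ m = (directLimitι F).app i ≫ n) : m = n := by
  have hbase : Hom.base m = Hom.base n := ContinuousMap.ext fun y => Subtype.ext <| funext fun i =>
    congrArg (fun f : F.obj i ⟶ E => Hom.base f y) (h i)
  obtain ⟨b, f, _⟩ := m
  obtain ⟨b', g, _⟩ := n
  obtain rfl : b = b' := hbase
  refine Hom.ext_val (fun _ => rfl) fun y t t' htt' => ?_
  obtain rfl : t = t' := EtFibre.ext htt'
  obtain ⟨i, a, rfl⟩ := exists_fibreMk_eq F _ t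
  exact Hom.fib_congr (h i) rfl (a := a) (b := a) rfl

/-- The direct limit is the colimit in the category of étale spaces of `R`-modules. -/
noncomputable def directLimitIsColimit :
    IsColimit (Cocone.mk (directLimit F (directLimitStr F)) (directLimitι F)) where
  desc := directLimitDesc F
  fac := directLimitι_app_comp_directLimitDesc F
  uniq s _ hm := hom_ext_of_directLimitι F fun i =>
    (hm i).trans (directLimitι_app_comp_directLimitDesc F s i).symm

end DirectLimit

namespace EtaleMod

variable {R : Type w} [Ring R] [TopologicalSpace R]

theorem isOpen_eqLocus (E : EtaleMod.{u, w} R) (s t : E.sections) :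
    IsOpen {x | s.1 x = t.1 x} := by
  have h := E.str.isLocalHomeomorph.isLocallyInjective.isOpen_eqLocus
    (g₁ := fun x => (s.1 x).1) (g₂ := fun x => (t.1 x).1) s.2 t.2
    (funext fun x => (s.1 x).2.trans (t.1 x).2.symm)
  exact (congrArg IsOpen (Set.ext fun x => EtFibre.ext_iff)).mpr h

open Classical in
theorem piecewise_mem_sections (E : EtaleMod.{u, w} R) {s t : ∀ x, E.Fibre x} {U : Set E.base}
    (hU : IsClopen U) (hs : ContinuousOn (fun x => (s x).1) U)
    (ht : ContinuousOn (fun x => (t x).1) Uᶜ) : U.piecewise s t ∈ E.sections := by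
  have h : Continuous (U.piecewise (fun x => (s x).1) fun x => (t x).1) :=
    continuous_piecewise (by simp [hU.frontier_eq]) (by rwa [hU.isClosed.closure_eq])
      (by rwa [hU.compl.isClosed.closure_eq])
  exact h.congr fun x => (U.apply_piecewise s t fun _ => EtFibre.val).symm

open Classical in
/-- The global section which is `s` on the clopen set `U` and `t` on its complement. -/
noncomputable def glue (E : EtaleMod.{u, w} R) {U : Set E.base} (hU : IsClopen U)
    (s t : E.sections) : E.sections :=
  ⟨U.piecewise s.1 t.1, E.piecewise_mem_sections hU (Continuous.continuousOn s.2)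
    (Continuous.continuousOn t.2)⟩

theorem sectionsMap_glue {E F : EtaleMod.{u, w} R} (f : E ⟶ F) {U : Set E.base} (hU : IsClopen U)
    (s t : E.sections) :
    sectionsMap f (E.glue hU s t) =
      F.glue (hU.preimage (map_continuous (Hom.base f))) (sectionsMap f s) (sectionsMap f t) := by
  classical
  refine Subtype.ext (funext fun y => ?_)
  by_cases hy : Hom.base f y ∈ U
  · exact (congrArg (Hom.fib f y) (U.piecewise_eq_of_mem s.1 t.1 hy)).trans
      (Set.piecewise_eq_of_mem (Hom.base f ⁻¹' U) (sectionsMap f s).1 (sectionsMap f t).1 hy).symm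
  · exact (congrArg (Hom.fib f y) (U.piecewise_eq_of_notMem s.1 t.1 hy)).trans
      (Set.piecewise_eq_of_notMem (Hom.base f ⁻¹' U) (sectionsMap f s).1 (sectionsMap f t).1
        hy).symm

theorem exists_section_through (E : EtaleMod.{u, w} R) {x : E.base} (a : E.Fibre x) :
    ∃ s : E.sections, s.1 x = a := by
  classical
  obtain ⟨a, rfl⟩ := a
  obtain ⟨e, hae, he⟩ := E.str.isLocalHomeomorph a
  have hpe (b : E.total) : E.proj b = e b := congrFun he b
  have ha : E.proj a ∈ e.target := by rw [hpe]; exact e.map_source hae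
  obtain ⟨U, hU, haU, hUe⟩ := compact_exists_isClopen_in_isOpen e.open_target ha
  let σ (y : E.base) : E.Fibre y := if h : E.proj (e.symm y) = y then ⟨e.symm y, h⟩ else 0
  have hσ {y : E.base} (hy : y ∈ U) : (σ y).1 = e.symm y :=
    congrArg EtFibre.val (dif_pos ((hpe _).trans (e.right_inv (hUe hy))))
  refine ⟨⟨U.piecewise σ 0, E.piecewise_mem_sections hU
    ((e.continuousOn_symm.mono hUe).congr fun y hy => hσ hy)
    E.str.continuous_zero.continuousOn⟩, ?_⟩
  exact (U.piecewise_eq_of_mem σ 0 haU).trans (EtFibre.ext ((hσ haU).trans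
    ((congrArg e.symm (hpe a)).trans (e.left_inv hae))))

theorem mem_of_forall_glue_mem (E : EtaleMod.{u, w} R) {N : Set E.sections} (hN : N.Nonempty)
    (hglue : ∀ (U : Set E.base) (hU : IsClopen U), ∀ s ∈ N, ∀ t ∈ N, E.glue hU s t ∈ N)
    (hpt : ∀ (x : E.base) (a : E.Fibre x), ∃ s ∈ N, s.1 x = a) (s : E.sections) : s ∈ N := by
  classical
  suffices ∃ U : Set E.base, IsClopen U ∧ Set.univ ⊆ U ∧ ∃ t ∈ N, ∀ x ∈ U, t.1 x = s.1 x by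
    obtain ⟨U, -, hU, t, ht, hts⟩ := this
    rwa [← show t = s from Subtype.ext (funext fun x => hts x (hU trivial))]
  refine isCompact_univ.induction_on (p := fun K : Set E.base => ∃ U : Set E.base, IsClopen U ∧
    K ⊆ U ∧ ∃ t ∈ N, ∀ x ∈ U, t.1 x = s.1 x) ?_ ?_ ?_ fun x _ => ?_
  · obtain ⟨t, ht⟩ := hN
    exact ⟨∅, isClopen_empty, subset_rfl, t, ht, fun _ => False.elim⟩
  · rintro K L hKL ⟨U, hU, hLU, h⟩
    exact ⟨U, hU, hKL.trans hLU, h⟩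
  · rintro K L ⟨U, hU, hK, t, ht, hts⟩ ⟨V, hV, hL, t', ht', hts'⟩
    refine ⟨U ∪ V, hU.union hV, Set.union_subset_union hK hL, _, hglue U hU t ht t' ht',
      fun x hx => ?_⟩
    by_cases hxU : x ∈ U
    · exact (U.piecewise_eq_of_mem t.1 t'.1 hxU).trans (hts x hxU)
    · exact (U.piecewise_eq_of_notMem t.1 t'.1 hxU).trans (hts' x (hx.resolve_left hxU))
  · obtain ⟨t, ht, htx⟩ := hpt x (s.1 x)
    obtain ⟨U, hU, hxU, hUeq⟩ := compact_exists_isClopen_in_isOpen (E.isOpen_eqLocus t s) htx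
    exact ⟨U, mem_nhdsWithin_of_mem_nhds (hU.isOpen.mem_nhds hxU), U, hU, subset_rfl, t, ht,
      fun _ hy => hUeq hy⟩

/-- The contravariant functor sending an étale space of `R`-modules to its base space. -/
def baseFunctor (R : Type w) [Ring R] [TopologicalSpace R] :
    (EtaleMod.{u, w} R)ᵒᵖ ⥤ Profinite.{u} where
  obj E := E.unop.base
  map f := CompHausLike.ofHom _ (Hom.base f.unop)

end EtaleMod

section Bases

variable {R : Type w} [Ring R] [TopologicalSpace R] {I : Type u} [Preorder I]
  (F : I ⥤ EtaleMod.{u, w} R)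

namespace BaseLim

/-- The inverse limit of the base spaces as a cone of profinite spaces. -/
def cone : Cone (F.op ⋙ baseFunctor R) where
  pt := Profinite.of (BaseLim F)
  π :=
    { app := fun i => CompHausLike.ofHom _ (BaseLim.π F i.unop)
      naturality := fun i j f => ConcreteCategory.hom_ext _ _ fun x =>
        (x.2 j.unop i.unop (leOfHom f.unop)).symm }

/-- The inverse limit of the base spaces is their limit in the category of profinite spaces. -/
def coneIsLimit : IsLimit (cone F) where
  lift s := CompHausLike.ofHom _
    { toFun := fun y => ⟨fun i => s.π.app (.op i) y, fun i _ h =>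
        congrArg (fun f : s.pt ⟶ (F.obj i).base => f y) (s.w (homOfLE h).op)⟩
      continuous_toFun :=
        (continuous_pi fun i => (s.π.app (.op i)).hom.hom.continuous).subtype_mk _ }
  fac _ _ := rfl
  uniq s _ hm := ConcreteCategory.hom_ext _ _ fun y => Subtype.ext <| funext fun i =>
    congrArg (fun f : s.pt ⟶ (F.obj i).base => f y) (hm (.op i))

variable [IsDirectedOrder I] [Nonempty I]

theorem exists_preimage_eq_of_isClopen {U : Set (BaseLim F)} (hU : IsClopen U) :
    ∃ (i : I) (V : Set (F.obj i).base), IsClopen V ∧ U = BaseLim.π F i ⁻¹' V :=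
  let ⟨i, V, hV, h⟩ := Profinite.exists_isClopen_of_cofiltered (cone F) (coneIsLimit F) hU
  ⟨i.unop, V, hV, h⟩

theorem exists_eq_univ_of_isOpen {Z : ∀ i, Set (F.obj i).base} (hZ : ∀ i, IsOpen (Z i))
    (hmono : ∀ i j (h : i ≤ j), ∀ y, Hom.base (F.map (homOfLE h)) y ∈ Z i → y ∈ Z j)
    (hcover : ∀ x : BaseLim F, ∃ i, BaseLim.π F i x ∈ Z i) : ∃ i, Z i = Set.univ := by
  by_contra! hne
  let G : Iᵒᵖ ⥤ TopCat.{u} :=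
    { obj := fun i => TopCat.of ↥(Z i.unop)ᶜ
      map := fun {i j} f => TopCat.ofHom
        ⟨fun y => ⟨Hom.base (F.map f.unop) y.1, fun h => y.2 (hmono _ _ (leOfHom f.unop) _ h)⟩,
          by fun_prop⟩ }
  have (i : Iᵒᵖ) : Nonempty (G.obj i) := (Set.nonempty_compl.2 (hne i.unop)).to_subtype
  have (i : Iᵒᵖ) : CompactSpace (G.obj i) :=
    isCompact_iff_compactSpace.1 (hZ i.unop).isClosed_compl.isCompact
  have (i : Iᵒᵖ) : T2Space (G.obj i) := inferInstanceAs (T2Space ↥(Z i.unop)ᶜ)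
  obtain ⟨y, hy⟩ := TopCat.nonempty_limitCone_of_compact_t2_cofiltered_system G
  obtain ⟨i, hi⟩ := hcover ⟨fun i => (y (.op i)).1, fun i j h =>
    congrArg Subtype.val (hy (homOfLE h).op)⟩
  exact (y (.op i)).2 hi

end BaseLim

end Bases

section ContinuousProduct

variable {R : Type w} [Ring R] [TopologicalSpace R] {I : Type u} [Preorder I]
  (F : I ⥤ EtaleMod.{u, w} R)

theorem sectionsMap_map_map {i j k : I} (h : i ≤ j) (h' : j ≤ k) (s : (F.obj i).sections) :
    sectionsMap (F.map (homOfLE h')) (sectionsMap (F.map (homOfLE h)) s) =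
      sectionsMap (F.map (homOfLE (h.trans h'))) s :=
  congrArg (fun f : F.obj i ⟶ F.obj k => sectionsMap f s)
    (F.map_comp (homOfLE h) (homOfLE h')).symm

theorem sectionsMap_map_apply {i k : I} (h : i ≤ k) (s : (F.obj i).sections) (x : BaseLim F) :
    (sectionsMap (F.map (homOfLE h)) s).1 (BaseLim.π F k x) =
      fibreTransition F x i k h (s.1 (BaseLim.π F i x)) :=
  EtFibre.ext (Hom.fib_congr rfl rfl (congrArg (fun y => (s.1 y).1) (x.2 i k h)))

variable [IsDirectedOrder I] [Nonempty I]

theorem sectionsMap_directLimitι_map {i j : I} (h : i ≤ j) (s : (F.obj i).sections) :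
    sectionsMap ((directLimitι F).app j) (sectionsMap (F.map (homOfLE h)) s) =
      sectionsMap ((directLimitι F).app i) s :=
  congrArg (fun f : F.obj i ⟶ directLimit F (directLimitStr F) => sectionsMap f s)
    ((directLimitι F).naturality (homOfLE h))

theorem exists_sectionsMap_directLimitι_eq_glue {U : Set (BaseLim F)}
    (hU : IsClopen (X := (directLimit F (directLimitStr F)).base) U) {i j : I}
    (s : (F.obj i).sections) (t : (F.obj j).sections) :
    ∃ (k : I) (r : (F.obj k).sections), sectionsMap ((directLimitι F).app k) r =
      glue _ hU (sectionsMap ((directLimitι F).app i) s)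
        (sectionsMap ((directLimitι F).app j) t) := by
  obtain ⟨l, V, hV, rfl⟩ := BaseLim.exists_preimage_eq_of_isClopen F hU
  obtain ⟨k, hi, hj, hl⟩ : ∃ k, i ≤ k ∧ j ≤ k ∧ l ≤ k := by
    obtain ⟨m, hi, hj⟩ := exists_ge_ge i j
    obtain ⟨k, hm, hl⟩ := exists_ge_ge m l
    exact ⟨k, hi.trans hm, hj.trans hm, hl⟩
  have hW := hV.preimage (map_continuous (Hom.base (F.map (homOfLE hl))))
  refine ⟨k, glue _ hW (sectionsMap (F.map (homOfLE hi)) s) (sectionsMap (F.map (homOfLE hj)) t),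
    ?_⟩
  rw [sectionsMap_glue, sectionsMap_directLimitι_map, sectionsMap_directLimitι_map]
  congr 1
  exact Set.ext fun x => iff_of_eq (congrArg (· ∈ V) (x.2 l k hl))

theorem exists_sectionsMap_directLimitι_eq (s : (directLimit F (directLimitStr F)).sections) :
    ∃ (i : I) (t : (F.obj i).sections), sectionsMap ((directLimitι F).app i) t = s := by
  refine mem_of_forall_glue_mem _ (N := {s | ∃ (i : I) (t : (F.obj i).sections),
    sectionsMap ((directLimitι F).app i) t = s}) ?_ ?_ ?_ s
  · obtain ⟨i⟩ := ‹Nonempty I›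
    exact ⟨_, i, 0, rfl⟩
  · rintro U hU _ ⟨i, s, rfl⟩ _ ⟨j, t, rfl⟩
    exact exists_sectionsMap_directLimitι_eq_glue F hU s t
  · intro x a
    obtain ⟨i, b, rfl⟩ := TotalLim.exists_fibreMk_eq F x a
    obtain ⟨t, rfl⟩ := (F.obj i).exists_section_through b
    exact ⟨_, ⟨i, t, rfl⟩, rfl⟩

theorem exists_sectionsMap_map_eq_zero {i : I} (s : (F.obj i).sections)
    (hs : sectionsMap ((directLimitι F).app i) s = 0) :
    ∃ (k : I) (h : i ≤ k), sectionsMap (F.map (homOfLE h)) s = 0 := by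
  let Z (k : I) : Set (F.obj k).base :=
    {y | ∃ h : i ≤ k, (sectionsMap (F.map (homOfLE h)) s).1 y = 0}
  have hZ (k : I) : IsOpen (Z k) := by
    by_cases h : i ≤ k
    · convert (F.obj k).isOpen_eqLocus (sectionsMap (F.map (homOfLE h)) s) 0 using 1
      exact Set.ext fun y => exists_prop_of_true h
    · convert isOpen_empty
      exact Set.ext fun y => iff_of_false (fun hy => h hy.1) id
  have hmono (j k : I) (h : j ≤ k) (y : (F.obj k).base)
      (hy : Hom.base (F.map (homOfLE h)) y ∈ Z j) : y ∈ Z k := by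
    obtain ⟨hij, hy⟩ := hy
    refine ⟨hij.trans h, ?_⟩
    rw [← sectionsMap_map_map F hij h]
    exact (congrArg (Hom.fib (F.map (homOfLE h)) y) hy).trans (map_zero _)
  have hcover (x : BaseLim F) : ∃ k, BaseLim.π F k x ∈ Z k := by
    have hx : TotalLim.fibreMk F x i (s.1 (BaseLim.π F i x)) = TotalLim.fibreMk F x i 0 :=
      (congrFun (congrArg Subtype.val hs) x).trans (map_zero (TotalLim.fibreMk F x i)).symm
    obtain ⟨k, h, h', e⟩ := (TotalLim.mk_eq_mk_iff F x _ _).1 (congrArg EtFibre.val hx)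
    exact ⟨k, h, (sectionsMap_map_apply F h s x).trans (e.trans (map_zero _))⟩
  obtain ⟨j, hj⟩ := BaseLim.exists_eq_univ_of_isOpen F hZ hmono hcover
  obtain ⟨k, hik, hjk⟩ := exists_ge_ge i j
  exact ⟨k, hik, Subtype.ext (funext fun y => (hmono j k hjk y (hj.symm.le trivial)).2)⟩

end ContinuousProduct

theorem mainTheorem9_general {R : Type w} [Ring R] [TopologicalSpace R]
    {I : Type u} [Preorder I] [IsDirectedOrder I] [Nonempty I] (F : I ⥤ EtaleMod.{u, w} R) :
    ∃ (S : EtaleModStr R (TotalLim.proj F))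
      (ι : F ⟶ (Functor.const I).obj (directLimit F S)),
      (∀ i : I, EtaleMod.Hom.base (ι.app i) = BaseLim.π F i) ∧
      (∀ (i : I) (x : BaseLim F)
        (h : EtaleMod.Hom.base (ι.app i) x = BaseLim.π F i x)
        (a : (F.obj i).Fibre (EtaleMod.Hom.base (ι.app i) x)),
        (EtaleMod.Hom.fib (ι.app i) x a).1 = TotalLim.mk F i x ⟨a.1, a.2.trans h⟩) ∧
      Nonempty (IsColimit (Cocone.mk (directLimit F S) ι)) ∧
      Nonempty (IsColimit ((contProd R).mapCocone (Cocone.mk (directLimit F S) ι))) ∧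
      Nonempty (IsColimit ((contProd R ⋙ (IsDiscreteModule.{u, w} R).ι).mapCocone
        (Cocone.mk (directLimit F S) ι))) := by
  refine ⟨directLimitStr F, directLimitι F, fun _ => rfl, fun i x _ a => rfl,
    ⟨directLimitIsColimit F⟩, ?_⟩
  obtain ⟨hc⟩ : Nonempty (IsColimit ((contProd R ⋙ (IsDiscreteModule.{u, w} R).ι).mapCocone
      (Cocone.mk (directLimit F (directLimitStr F)) (directLimitι F)))) :=
    nonempty_isColimit_of_forall_exists _ (exists_sectionsMap_directLimitι_eq F)
      fun _ => exists_sectionsMap_map_eq_zero F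
  exact ⟨⟨isColimitOfReflects (IsDiscreteModule.{u, w} R).ι hc⟩, ⟨hc⟩⟩

theorem mainTheorem9 {R : Type w} [Ring R] [TopologicalSpace R] [IsTopologicalRing R]
    [CompactSpace R] [T2Space R] [TotallyDisconnectedSpace R]
    {I : Type u} [Preorder I] [IsDirectedOrder I] [Nonempty I] (F : I ⥤ EtaleMod.{u, w} R) :
    ∃ (S : EtaleModStr R (TotalLim.proj F))
      (ι : F ⟶ (Functor.const I).obj (directLimit F S)),
      (∀ i : I, EtaleMod.Hom.base (ι.app i) = BaseLim.π F i) ∧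
      (∀ (i : I) (x : BaseLim F)
        (h : EtaleMod.Hom.base (ι.app i) x = BaseLim.π F i x)
        (a : (F.obj i).Fibre (EtaleMod.Hom.base (ι.app i) x)),
        (EtaleMod.Hom.fib (ι.app i) x a).1 = TotalLim.mk F i x ⟨a.1, a.2.trans h⟩) ∧
      Nonempty (IsColimit (Cocone.mk (directLimit F S) ι)) ∧
      Nonempty (IsColimit ((contProd R).mapCocone (Cocone.mk (directLimit F S) ι))) ∧
      Nonempty (IsColimit ((contProd R ⋙ (IsDiscreteModule.{u, w} R).ι).mapCocone
        (Cocone.mk (directLimit F S) ι))) :=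
  mainTheorem9_general F
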